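/- Let $\mathfrak C$ be a monster model of a complete first-order theory in a language $L$: $\mathfrak C$ is $\kappa$-saturated and strongly $\kappa$-homogeneous, where $\kappa$ is so large that every set-sized cardinal is below it; "small" means of size less than $\kappa$. A set of tuples indexed by a small set is *type-definable* if it is the set of realizations in $\mathfrak C$ of a partial type over a small set of parameters. **Dividing depth.** Let $S$ be a type-definable set of $I$-tuples, $x=(x_i)_{i\in I}$. For an ordinal $\alpha$, a *dividing tree of depth $\alpha$ in $S$* consists of formulas $(\varphi_j(x,y_j)\in L: j<\alpha)$ with finite tuples $y_j$, numbers $(k_j\in\omega: j<\alpha)$, and parameters $(a_{s,i}: s\in\omega^{<\alpha}, i<\omega)$ from $\mathfrak C$ such that (a) for each $s\in\omega^{<\alpha}$, of length $|s|$, the family $\{\varphi_{|s|}(x,a_{s,i}): i<\omega\}$ is $k_{|s|}$-inconsistent, i.e. no $k_{|s|}$ members of it (with distinct indices $i$) are jointly satisfiable; (b) for each $f:\alpha\to\omega$ some element of $S$ satisfies all $\varphi_j(x,a_{f\restriction j,f(j)})$, $j<\alpha$. The *dividing depth* $DD(S)$ is the supremum of the depths of dividing trees in $S$, and $DD(S)=\infty$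 if these depths are unbounded. If the supremum is a limit ordinal $\alpha$ and there is no dividing tree of depth $\alpha$ in $S$, we write $DD(S)=\alpha_-$; in all other cases in which the supremum $\alpha$ exists we write $DD(S)=\alpha_+$. **Extended ordinals.** Consider the symbols $\alpha_-$ and $\alpha_+$, for ordinals $\alpha$, and $\infty$, ordered by $\alpha_-<\alpha_+<\beta_-<\beta_+<\infty$ for $\alpha<\beta$. (The symbols $\alpha_-$ with $\alpha$ not a limit are only formal upper bounds; they are never values of $DD$.) Write $\oplus$ for the natural (Hessenberg) sum of ordinals. Define $$\alpha_-\hat+\beta_-=(\sup\{\gamma+\beta:\gamma<\alpha\})_-,\qquad \alpha_+\hat+\beta_-=(\alpha+\beta)_-,\qquad \alpha_+\hat+\beta_+=(\alpha+\beta)_+,$$ and let $\alpha_-\hat+\beta_+$ be $\sigma_+$ or $\sigma_-$, where $\sigma=\sup\{\gamma+\beta:\gamma<\alpha\}$, according to whether $\sigma$ is attained or not. Define $$\alpha_-\hat\oplus\beta_-=(\sup\{\gamma\oplus\delta:\gamma<\alpha,\ \delta<\beta\})_-,\qquad \alpha_+\hat\oplus\beta_-=\alpha_-\hat\oplus\beta_+=(\alpha\oplus\beta)_-,\qquad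 \alpha_+\hat\oplus\beta_+=(\alpha\oplus\beta)_+.$$ Both operations give $\infty$ if one of the arguments is $\infty$. **Proposition.** Let $S$ and $T$ be nonempty type-definable sets. Then $$\max\bigl(DD(S)\,\hat+\,DD(T),\ DD(T)\,\hat+\,DD(S)\bigr)\ \le\ DD(S\times T)\ \le\ DD(S)\,\hat\oplus\,DD(T).$$ -/

import Mathlib

open scoped FirstOrder

universe u v

namespace DividingDepth

noncomputable section

/-! ### Monster models -/

/-- `M` is a monster model (of its complete theory): it is `κ`-saturated and strongly
`κ`-homogeneous, where `κ` is the size of the universe `Type u`. In other words the small sets of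
parameters are those that are in bijection with a type in `Type u`; `M` itself may live in a larger
universe `Type v`. Every set-sized ordinal, that is, every element of `Ordinal.{u}`, is below
`κ`. -/
structure IsMonster (L : FirstOrder.Language.{u, u}) (M : Type v) [L.Structure M] : Prop where
  /-- Saturation: a partial type in one variable over a small set `A`, given as a family of
  `A`-definable subsets of `M`, is realized as soon as it is finitely satisfiable. -/
  saturated : ∀ A : Set M, Small.{u} A → ∀ F : Set (Set M), (∀ X ∈ F, A.Definable₁ L X) →
    (∀ G ⊆ F, G.Finite → (⋂₀ G).Nonempty) → (⋂₀ F).Nonempty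
  /-- Strong homogeneity: a partial elementary map with small domain extends to an
  automorphism. -/
  homogeneous : ∀ A : Set M, Small.{u} A → ∀ f : A → M,
    (∀ φ : L.Formula A, φ.Realize f ↔ φ.Realize ((↑) : A → M)) →
    ∃ g : M ≃[L] M, ∀ a : A, g a = f a

/-- `S` is type-definable: the set of realizations of a partial type over a small set of
parameters `A`, that is, an intersection of `A`-definable sets. -/
def IsTypeDefinable (L : FirstOrder.Language.{u, u}) {M : Type v} [L.Structure M] {ι : Type u}
    (S : Set (ι → M)) : Prop :=
  ∃ A : Set M, Small.{u} A ∧ ∃ F : Set (Set (ι → M)), (∀ X ∈ F, A.Definable L X) ∧ S = ⋂₀ F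

/-- The Cartesian product of a set of `ι`-tuples and a set of `κ`-tuples, as a set of
`ι ⊕ κ`-tuples. -/
def tupleProd {M : Type v} {ι κ : Type u} (S : Set (ι → M)) (T : Set (κ → M)) :
    Set (ι ⊕ κ → M) :=
  {c | c ∘ Sum.inl ∈ S ∧ c ∘ Sum.inr ∈ T}

/-! ### Dividing trees -/

/-- There is a dividing tree of depth `α` in `S`: formulas `φ j (x, y_j)` of `L` and numbers `k j`
for `j < α`, and parameters `a j s i` for every `s` of length `j < α` with entries in `ω` and
every `i < ω`, such that

* for each node `s` the family `{φ j (x, a j s i) : i < ω}` is `k j`-inconsistent, where `j` is the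
  length of `s`: no `k j` members of it have a common solution;
* for each branch `f : α → ω` the formulas `φ j (x, a j (f ↾ j) (f j))`, `j < α`, are consistent
  with `S`.

In a monster model a small partial type is consistent exactly if it has a realization. -/
def HasDividingTree (L : FirstOrder.Language.{u, u}) {M : Type v} [L.Structure M] {ι : Type u}
    (S : Set (ι → M)) (α : Ordinal.{u}) : Prop :=
  ∃ (m : Set.Iio α → ℕ) (φ : ∀ j : Set.Iio α, L.Formula (ι ⊕ Fin (m j))) (k : Set.Iio α → ℕ)
    (a : ∀ j : Set.Iio α, (Set.Iio j.1 → ℕ) → ℕ → Fin (m j) → M),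
    (∀ (j : Set.Iio α) (s : Set.Iio j.1 → ℕ) (I : Finset ℕ), I.card = k j →
      ¬ ∃ x : ι → M, ∀ i ∈ I, (φ j).Realize (Sum.elim x (a j s i))) ∧
    (∀ f : Set.Iio α → ℕ, ∃ x ∈ S, ∀ j : Set.Iio α,
      (φ j).Realize (Sum.elim x (a j (fun l => f ⟨l.1, (Set.mem_Iio.1 l.2).trans j.2⟩) (f j))))

/-! ### Extended ordinals -/

/-- Extended ordinals together with `∞ = ⊤`. The pair `(α, false)` is `α₋` and `(α, true)` is
`α₊`; the order is lexicographic, so `α₋ < α₊ < β₋ < β₊ < ∞` for `α < β`. The symbols `α₋` with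
`α` not a limit ordinal are kept as formal symbols; they are never the dividing depth of a set. -/
abbrev ExtOrd : Type (u + 1) := WithTop (Ordinal.{u} ×ₗ Bool)

/-- The extended ordinal `α₋`. -/
def ominus (α : Ordinal.{u}) : ExtOrd.{u} := ((toLex (α, false) : Ordinal.{u} ×ₗ Bool) : ExtOrd)

/-- The extended ordinal `α₊`. -/
def oplus (α : Ordinal.{u}) : ExtOrd.{u} := ((toLex (α, true) : Ordinal.{u} ×ₗ Bool) : ExtOrd)

open Classical in
/-- The dividing depth of `S`: the supremum of the depths of dividing trees in `S`, with the
subscript `₋` if it is a limit ordinal that is not itself the depth of such a tree, and `₊`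
otherwise; it is `∞` if the depths are unbounded. -/
def DD (L : FirstOrder.Language.{u, u}) {M : Type v} [L.Structure M] {ι : Type u}
    (S : Set (ι → M)) : ExtOrd.{u} :=
  if BddAbove {α | HasDividingTree L S α} then
    if Order.IsSuccLimit (sSup {α | HasDividingTree L S α}) ∧
        ¬ HasDividingTree L S (sSup {α | HasDividingTree L S α}) then
      ominus (sSup {α | HasDividingTree L S α})
    else
      oplus (sSup {α | HasDividingTree L S α})
  else ⊤

/-- The natural (Hessenberg) sum of ordinals: the least ordinal greater than all `γ ⊕ β` with
`γ < α` and all `α ⊕ δ` with `δ < β`. -/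
def natSum (α β : Ordinal.{u}) : Ordinal.{u} :=
  max (⨆ γ : Set.Iio α, Order.succ (natSum γ.1 β)) (⨆ δ : Set.Iio β, Order.succ (natSum α δ.1))
termination_by (α, β)
decreasing_by
  · exact Prod.Lex.left _ _ γ.2
  · exact Prod.Lex.right _ δ.2

open Classical in
/-- The sum `+̂` on pairs, the second component being `true` for `₊` and `false` for `₋`. -/
def hatAddAux : Ordinal.{u} × Bool → Ordinal.{u} × Bool → ExtOrd.{u}
  | (α, false), (β, false) => ominus (sSup {ξ | ∃ γ < α, ξ = γ + β})
  | (α, false), (β, true) =>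
      if sSup {ξ | ∃ γ < α, ξ = γ + β} ∈ {ξ | ∃ γ < α, ξ = γ + β} then
        oplus (sSup {ξ | ∃ γ < α, ξ = γ + β})
      else ominus (sSup {ξ | ∃ γ < α, ξ = γ + β})
  | (α, true), (β, false) => ominus (α + β)
  | (α, true), (β, true) => oplus (α + β)

/-- The natural sum `⊕̂` on pairs, the second component being `true` for `₊` and `false`
for `₋`. -/
def hatNatAddAux : Ordinal.{u} × Bool → Ordinal.{u} × Bool → ExtOrd.{u}
  | (α, false), (β, false) => ominus (sSup {ξ | ∃ γ < α, ∃ δ < β, ξ = natSum γ δ})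
  | (α, false), (β, true) => ominus (natSum α β)
  | (α, true), (β, false) => ominus (natSum α β)
  | (α, true), (β, true) => oplus (natSum α β)

/-- The sum `+̂` of extended ordinals; it is `∞` if one of the summands is. -/
def hatAdd : ExtOrd.{u} → ExtOrd.{u} → ExtOrd.{u}
  | ⊤, _ => ⊤
  | _, ⊤ => ⊤
  | (x : Ordinal.{u} ×ₗ Bool), (y : Ordinal.{u} ×ₗ Bool) => hatAddAux (ofLex x) (ofLex y)

/-- The natural sum `⊕̂` of extended ordinals; it is `∞` if one of the summands is. -/
def hatNatAdd : ExtOrd.{u} → ExtOrd.{u} → ExtOrd.{u}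
  | ⊤, _ => ⊤
  | _, ⊤ => ⊤
  | (x : Ordinal.{u} ×ₗ Bool), (y : Ordinal.{u} ×ₗ Bool) => hatNatAddAux (ofLex x) (ofLex y)

end

end DividingDepth

/-! Lower bound: on top of every branch of a tree in `S` put the same tree in `T`. The two families
of formulas constrain disjoint coordinates, so realizations can be paired freely and depths add, in
either order.

Upper bound: replace trees by chains. A tree of depth `α` in a type-definable set amounts to one
element `c` of the set and small sets `B j ⊆ B' j`, with `B' j ⊆ B j'` for `j < j'`, such that the
type of `c` over `B' j` divides over `B j` for all `j < α`. From tree to chain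
(`HasTreeOn.exists_chain`), compactness widens the branching beyond the number of types, and
pigeonhole finds a branch with infinitely many siblings of equal type at each level. From chain to
tree (`HasDividingChain.hasTreeOn`), automorphisms copy the dividing witnesses to every node. For a
pair `(c, d)`, left transitivity (`Divides.or_of_sum`) assigns each step of a chain to `c`, or to
`d` after `c` is added to all sets. The index order splits into two suborders, and `le_natSum_type`
bounds its type by the natural sum of theirs.

The signs `₊`, `₋` are handled by `oplus_le_DD` and `IsProper.le_of_forall`, which reduce
inequalities between depths to the existence of trees. -/

namespace DividingDepth

open FirstOrder FirstOrder.Language Set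

/-! ### Types, homogeneity and saturation for small tuples -/

section Formulas

variable {L : FirstOrder.Language.{u, u}} {M : Type v} [L.Structure M]

/-- A formula is equivalent to one in finitely many of its variables. -/
theorem exists_finset_support {P : Type*} (φ : L.Formula P) :
    ∃ (T : Finset P) (ψ : L.Formula T), ∀ x : P → M, ψ.Realize (fun p => x p) ↔ φ.Realize x := by
  classical
  exact ⟨φ.freeVarFinset, φ.restrictFreeVar id, fun x =>
    BoundedFormula.realize_restrictFreeVar x (fun _ => rfl)⟩

/-- Projections along arbitrarily many variables of definable sets of tuples are definable. -/
theorem exists_formula_ex {X V : Type*} (φ : L.Formula (X ⊕ V)) (x₀ : X → M) :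
    ∃ ψ : L.Formula V, ∀ v : V → M, ψ.Realize v ↔ ∃ x : X → M, φ.Realize (Sum.elim x v) := by
  classical
  let T := φ.freeVarFinset
  let T' : Finset X := T.toLeft
  let f : φ.freeVarFinset → V ⊕ T' := fun p => match p with
    | ⟨Sum.inl a, h⟩ => Sum.inr ⟨a, Finset.mem_toLeft.2 h⟩
    | ⟨Sum.inr a, _⟩ => Sum.inl a
  refine ⟨Formula.iExs T' (φ.restrictFreeVar f), fun v => ?_⟩
  rw [Formula.realize_iExs]
  constructor
  · rintro ⟨i, hi⟩
    -- Only the finitely many variables in `T'` are quantified; `x₀` fills the others, which do not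
    -- occur in `φ`.
    refine ⟨fun a => if h : a ∈ T' then i ⟨a, h⟩ else x₀ a, ?_⟩
    refine (BoundedFormula.realize_restrictFreeVar _ ?_).1 hi
    rintro ⟨a | a, h⟩
    · have : a ∈ T' := Finset.mem_toLeft.2 h
      simp [f, this]
    · rfl
  · rintro ⟨x, hx⟩
    refine ⟨fun a => x a, (BoundedFormula.realize_restrictFreeVar (Sum.elim x v) ?_).2 hx⟩
    rintro ⟨a | a, h⟩ <;> rfl

/-- The failure of a finite family of instances of a formula to have a common solution is a first
order condition on the parameters. -/
theorem exists_formula_inconsistent {X V P I : Type*} [Finite I] (φ : L.Formula (X ⊕ P))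
    (r : I → P → V) (x₀ : X → M) :
    ∃ ψ : L.Formula V, ∀ v : V → M, ψ.Realize v ↔
      ¬ ∃ x : X → M, ∀ i, φ.Realize (Sum.elim x (v ∘ r i)) := by
  obtain ⟨ψ, hψ⟩ := exists_formula_ex (V := V)
    (Formula.iInf fun i => φ.relabel (Sum.map id (r i))) x₀
  refine ⟨∼ψ, fun v => ?_⟩
  rw [Formula.realize_not, hψ]
  refine not_congr (exists_congr fun x => ?_)
  rw [Formula.realize_iInf]
  refine forall_congr' fun i => ?_
  rw [Formula.realize_relabel, Sum.elim_comp_map, Function.comp_id]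

variable (L) in
/-- Two tuples have the same complete type. -/
def EqTp {P : Type*} (x y : P → M) : Prop :=
  ∀ φ : L.Formula P, φ.Realize x ↔ φ.Realize y

namespace EqTp

theorem symm {P : Type*} {x y : P → M} (h : EqTp L x y) : EqTp L y x := fun φ => (h φ).symm

theorem trans {P : Type*} {x y z : P → M} (h : EqTp L x y) (h' : EqTp L y z) : EqTp L x z :=
  fun φ => (h φ).trans (h' φ)

theorem comp {P Q : Type*} {x y : P → M} (h : EqTp L x y) (r : Q → P) :
    EqTp L (x ∘ r) (y ∘ r) := fun φ => by
  simpa using h (φ.relabel r)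

theorem of_comp {P Q : Type*} {x y : P → M} (h : EqTp L x y) {x' y' : Q → M}
    (hr : ∀ q, ∃ p, x' q = x p ∧ y' q = y p) : EqTp L x' y' := by
  choose r hx hy using hr
  have := h.comp r
  rwa [show x ∘ r = x' from (funext hx).symm, show y ∘ r = y' from (funext hy).symm] at this

theorem of_equiv {P : Type*} (g : M ≃[L] M) (x : P → M) : EqTp L x (g ∘ x) :=
  fun φ => (StrongHomClass.realize_formula g φ).symm

theorem of_finite {P : Type*} {x y : P → M}
    (h : ∀ T : Finset P, EqTp L (fun p : T => x p) (fun p : T => y p)) : EqTp L x y := fun φ => by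
  obtain ⟨T, ψ, hψ⟩ := exists_finset_support (M := M) φ
  rw [← hψ x, ← hψ y]
  exact h T ψ

theorem of_imp {P : Type*} {x y : P → M} (h : ∀ φ : L.Formula P, φ.Realize x → φ.Realize y) :
    EqTp L x y := fun φ => ⟨h φ, fun hy => by
  by_contra hx
  exact (Formula.realize_not.1 (h (∼φ) (Formula.realize_not.2 hx))) hy⟩

theorem eq_of_eq {P : Type*} {x y : P → M} (h : EqTp L x y) {p q : P} (hpq : x p = x q) :
    y p = y q := by
  have := h ((Term.var p).equal (Term.var q))
  simpa [Formula.realize_equal, hpq] using this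

end EqTp

/-- Strong homogeneity for small tuples. -/
theorem IsMonster.exists_equiv (hM : IsMonster L M) {P : Type*} [Small.{u} P] {x y : P → M}
    (h : EqTp L x y) : ∃ g : M ≃[L] M, ∀ p, g (x p) = y p := by
  have hs : Small.{u} (range x) := small_range x
  choose r hr using fun a : range x => a.2
  obtain ⟨g, hg⟩ := hM.homogeneous (range x) hs (y ∘ r) fun φ => by
    have := (h.comp r φ).symm
    rwa [show x ∘ r = ((↑) : range x → M) from funext hr] at this
  refine ⟨g, fun p => ?_⟩
  rw [hg ⟨x p, p, rfl⟩]
  -- The chosen preimage of `x p` need not be `p`, but equality of coordinates is part of the type.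
  exact h.eq_of_eq (hr _)

/-- Recursion along a well-order: one may choose values one after the other as long as the
condition at each step depends on the earlier values only. -/
theorem exists_forall_of_step {W : Type*} [LinearOrder W] [WellFoundedLT W] {Y : W → Type*}
    [∀ j, Nonempty (Y j)] (Q : ∀ j, (∀ j, Y j) → Y j → Prop)
    (hQ : ∀ j f f', (∀ l < j, f l = f' l) → ∀ y, Q j f y → Q j f' y)
    (h : ∀ j f, (∀ l < j, Q l f (f l)) → ∃ y, Q j f y) : ∃ f, ∀ j, Q j f (f j) := by
  classical
  -- Dummy values from `j` on, where the condition at `j` does not look.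
  let d : ∀ j, Y j := fun j => Classical.arbitrary _
  let F : ∀ j, (∀ l, l < j → Y l) → Y j := fun j g =>
    Classical.epsilon (Q j (fun l => if hl : l < j then g l hl else d l))
  let f : ∀ j, Y j := (wellFounded_lt (α := W)).fix F
  have hf : ∀ j, f j = F j (fun l _ => f l) := fun j => WellFounded.fix_eq _ F j
  refine ⟨f, fun j => ?_⟩
  induction j using WellFoundedLT.induction with
  | ind j ih =>
    obtain ⟨y, hy⟩ := h j f ih
    have hg : ∀ l < j, f l = (fun l => if hl : l < j then f l else d l) l := fun l hl => by
      simp [hl]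
    have := Classical.epsilon_spec ⟨y, hQ j _ _ hg y hy⟩
    rw [hf j]
    exact hQ j _ _ (fun l hl => (hg l hl).symm) _ this

/-- Saturation for small tuples of variables: a type that is approximated, along an ultrafilter, by
tuples of `M` is realized in `M`. -/
theorem IsMonster.exists_realization (hM : IsMonster L M) {V : Type*} [Small.{u} V] {X : Type*}
    (U : Ultrafilter X) (e : X → V → M) {B : Type*} [Small.{u} B] (b : B → M) :
    ∃ c : V → M, ∀ φ : L.Formula (V ⊕ B), (∀ᶠ x in U, φ.Realize (Sum.elim (e x) b)) →
      φ.Realize (Sum.elim c b) := by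
  classical
  rcases isEmpty_or_nonempty V with hV | hV
  · refine ⟨isEmptyElim, fun φ hφ => ?_⟩
    obtain ⟨x, hx⟩ := hφ.exists
    rwa [Subsingleton.elim (isEmptyElim : V → M) (e x)]
  obtain ⟨x₀⟩ := Filter.nonempty_of_neBot (U : Filter X)
  obtain ⟨v₀⟩ := hV
  have : Nonempty M := ⟨e x₀ v₀⟩
  obtain ⟨_, _⟩ := exists_wellFoundedLT V
  -- Dependence on variables is taken semantically: with `b` fixed, the truth of `φ` is determined
  -- by the coordinates in `s`.
  let Supp : L.Formula (V ⊕ B) → Set V → Prop := fun φ s =>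
    ∀ x x' : V → M, EqOn x x' s → φ.Realize (Sum.elim x b) → φ.Realize (Sum.elim x' b)
  let Good : (V → M) → Set V → Prop := fun c s => ∀ φ : L.Formula (V ⊕ B), Supp φ s →
    (∀ᶠ x in U, φ.Realize (Sum.elim (e x) b)) → φ.Realize (Sum.elim c b)
  have good_of_forall : ∀ c s, (∀ l ∈ s, Good c (Iic l)) → Good c s := by
    intro c s h φ hφ hU
    obtain ⟨T, ψ, hψ⟩ := exists_finset_support (M := M) φ
    -- Semantic and syntactic support intersect: pass from `x` to `x'` through the tuple equal to
    -- `x` on `s` and to `x'` elsewhere. The intersection is finite, so its largest element decides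
    -- the initial segment needed.
    have hT : Supp φ (s ∩ T.toLeft) := by
      intro x x' hx hr
      have h1 : φ.Realize (Sum.elim (fun l => if l ∈ s then x l else x' l) b) :=
        hφ x _ (fun l hl => by simp [hl]) hr
      rw [← hψ] at h1 ⊢
      convert h1 using 1
      funext ⟨p, hp⟩
      rcases p with l | p
      · by_cases hl : l ∈ s
        · simp [hl, hx ⟨hl, Finset.mem_coe.2 (Finset.mem_toLeft.2 hp)⟩]
        · simp [hl]
      · rfl
    rcases (s ∩ T.toLeft).eq_empty_or_nonempty with h0 | h0
    · obtain ⟨x, hx⟩ := hU.exists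
      exact hT (e x) c (by simp [h0]) hx
    · obtain ⟨l, hl, hmax⟩ := exists_max_image (s ∩ T.toLeft) id
        ((Finset.finite_toSet _).subset inter_subset_right) h0
      exact h l hl.1 φ (fun x x' hx => hT x x' fun y hy => hx (hmax y hy)) hU
  let Q : V → (V → M) → M → Prop := fun v c m => ∀ φ : L.Formula (V ⊕ B), Supp φ (Iic v) →
    (∀ᶠ x in U, φ.Realize (Sum.elim (e x) b)) → φ.Realize (Sum.elim (Function.update c v m) b)
  suffices h : ∃ c, ∀ v, Q v c (c v) by
    obtain ⟨c, hc⟩ := h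
    refine ⟨c, fun φ hφ => good_of_forall c univ (fun l _ ψ hψ hU => ?_) φ
      (fun x x' hx => by rw [(eqOn_univ _ _).1 hx]; exact id) hφ⟩
    have := hc l ψ hψ hU
    rwa [Function.update_eq_self] at this
  refine exists_forall_of_step (Y := fun _ => M) Q ?_ ?_
  · intro v c c' hcc m h φ hφ hU
    refine hφ _ _ (fun l hl => ?_) (h φ hφ hU)
    rcases (mem_Iic.1 hl).eq_or_lt with rfl | hl
    · simp
    · simp [hl.ne, hcc l hl]
  · intro v c hc
    have hgood : Good c (Iio v) := good_of_forall c _ fun l hl ψ hψ hU => by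
      have := hc l hl ψ hψ hU
      rwa [Function.update_eq_self] at this
    have hA : Small.{u} ↑(range c ∪ range b) := small_union _ _
    let F : Set (Set M) := {Y | ∃ φ : L.Formula (V ⊕ B), Supp φ (Iic v) ∧
      (∀ᶠ x in U, φ.Realize (Sum.elim (e x) b)) ∧
      Y = {m | φ.Realize (Sum.elim (Function.update c v m) b)}}
    suffices h : (⋂₀ F).Nonempty by
      obtain ⟨m, hm⟩ := h
      exact ⟨m, fun φ hφ hU => hm _ ⟨φ, hφ, hU, rfl⟩⟩
    refine hM.saturated (range c ∪ range b) hA F ?_ ?_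
    · rintro _ ⟨φ, -, -, rfl⟩
      refine definable_iff_exists_formula_sum.2 ⟨φ.relabel (Sum.elim
        (fun l => if l = v then Sum.inr 0 else Sum.inl ⟨c l, Or.inl ⟨l, rfl⟩⟩)
        (fun p => Sum.inl ⟨b p, Or.inr ⟨p, rfl⟩⟩)), ?_⟩
      ext x
      simp only [mem_ofPred_eq, Formula.realize_relabel]
      apply iff_of_eq
      congr 1
      funext p
      rcases p with l | p
      · by_cases hl : l = v
        · subst hl; simp
        · simp [hl]
      · rfl
    · intro G hGF hG
      have : Finite G := hG
      choose φ hS hU hY using fun Y : G => hGF Y.2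
      let θ : L.Formula (V ⊕ B) := Formula.iInf φ
      -- Finite satisfiability at stage `v`: quantifying out coordinate `v` leaves a condition on
      -- earlier coordinates that holds along `U`, hence holds at `c`.
      let ψ : L.Formula (V ⊕ B) := Formula.iExs (Fin 1) (θ.relabel (Sum.elim
        (fun l => if l = v then Sum.inr 0 else Sum.inl (Sum.inl l))
        (fun p => Sum.inl (Sum.inr p))))
      have hψ : ∀ x : V → M, ψ.Realize (Sum.elim x b) ↔
          ∃ m, ∀ Y, (φ Y).Realize (Sum.elim (Function.update x v m) b) := by
        intro x
        simp only [ψ, θ, Formula.realize_iExs, Formula.realize_relabel]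
        have : ∀ i : Fin 1 → M, Sum.elim (Sum.elim x b) i ∘ (Sum.elim
            (fun l => if l = v then Sum.inr 0 else Sum.inl (Sum.inl l))
            (fun p => Sum.inl (Sum.inr p))) = Sum.elim (Function.update x v (i 0)) b := by
          intro i
          funext p
          rcases p with l | p
          · by_cases hl : l = v
            · subst hl; simp
            · simp [hl]
          · rfl
        simp only [this, Formula.realize_iInf]
        exact ⟨fun ⟨i, hi⟩ => ⟨i 0, hi⟩, fun ⟨m, hm⟩ => ⟨fun _ => m, hm⟩⟩
      have hψS : Supp ψ (Iio v) := by
        intro x x' hx h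
        rw [hψ] at h ⊢
        obtain ⟨m, hm⟩ := h
        refine ⟨m, fun Y => hS Y _ _ (fun l hl => ?_) (hm Y)⟩
        rcases (mem_Iic.1 hl).eq_or_lt with rfl | hl
        · simp
        · simp [hl.ne, hx hl]
      have hψU : ∀ᶠ x in U, ψ.Realize (Sum.elim (e x) b) := by
        filter_upwards [Filter.eventually_all.2 hU] with x hx
        refine (hψ _).2 ⟨e x v, fun Y => ?_⟩
        rw [Function.update_eq_self]
        exact hx Y
      obtain ⟨m, hm⟩ := (hψ c).1 (hgood ψ hψS hψU)
      refine ⟨m, fun Y hYG => ?_⟩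
      have h1 := hY ⟨Y, hYG⟩
      simp only at h1
      rw [h1]
      exact hm ⟨Y, hYG⟩

end Formulas

/-! ### Dividing, left transitivity and dividing chains -/

section Dividing

variable {L : FirstOrder.Language.{u, u}} {M : Type v} [L.Structure M]

variable (L) in
/-- The type of the tuple `c` over `B'` divides over `B`. -/
def Divides {ι : Type u} (c : ι → M) (B B' : Set M) : Prop :=
  ∃ (m : ℕ) (φ : L.Formula (ι ⊕ Fin m)) (k : ℕ) (b : Fin m → M) (bs : ℕ → Fin m → M),
    (∀ r, b r ∈ B') ∧ φ.Realize (Sum.elim c b) ∧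
    (∀ i, EqTp L (Sum.elim (bs i) ((↑) : B → M)) (Sum.elim b ((↑) : B → M))) ∧
    ∀ I : Finset ℕ, I.card = k → ¬ ∃ x : ι → M, ∀ i ∈ I, φ.Realize (Sum.elim x (bs i))

/-- To witness dividing one may use a formula with an arbitrary tuple of parameters. -/
theorem Divides.of_formula {ι : Type u} {c : ι → M} {B B' : Set M} {P : Type*}
    (φ : L.Formula (ι ⊕ P)) (k : ℕ) (b : P → M) (bs : ℕ → P → M) (hb : ∀ r, b r ∈ B')
    (hφ : φ.Realize (Sum.elim c b))
    (hbs : ∀ i, EqTp L (Sum.elim (bs i) ((↑) : B → M)) (Sum.elim b ((↑) : B → M)))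
    (hk : ∀ I : Finset ℕ, I.card = k →
      ¬ ∃ x : ι → M, ∀ i ∈ I, φ.Realize (Sum.elim x (bs i))) : Divides L c B B' := by
  obtain ⟨T, ψ, hψ⟩ := exists_finset_support (M := M) φ
  let e := T.toRight.equivFin
  let f : T → ι ⊕ Fin T.toRight.card := fun p => match p with
    | ⟨Sum.inl a, _⟩ => Sum.inl a
    | ⟨Sum.inr a, h⟩ => Sum.inr (e ⟨a, Finset.mem_toRight.2 h⟩)
  have key : ∀ (x : ι → M) (y : P → M), (ψ.relabel f).Realize
      (Sum.elim x (fun r => y (e.symm r))) ↔ φ.Realize (Sum.elim x y) := by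
    intro x y
    rw [Formula.realize_relabel, ← hψ]
    apply iff_of_eq
    congr 1
    funext ⟨p, hp⟩
    rcases p with p | p <;> simp [f]
  refine ⟨_, ψ.relabel f, k, fun r => b (e.symm r), fun i r => bs i (e.symm r),
    fun r => hb _, (key _ _).2 hφ, fun i => (hbs i).of_comp ?_, fun I hI => ?_⟩
  · rintro (r | r)
    · exact ⟨Sum.inl (e.symm r), rfl, rfl⟩
    · exact ⟨Sum.inr r, rfl, rfl⟩
  · simpa only [key] using hk I hI

/-- Left transitivity of non-dividing. -/
theorem Divides.or_of_sum (hM : IsMonster L M) {ι κ : Type u} {c : ι → M} {d : κ → M}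
    {B B' : Set M} [Small.{u} B] (hBB' : B ⊆ B') (h : Divides L (Sum.elim c d) B B') :
    Divides L c B B' ∨ Divides L d (B ∪ range c) (B' ∪ range c) := by
  classical
  refine or_iff_not_imp_left.2 fun hc => ?_
  obtain ⟨m, φ, k, b, bs, hb, hφ, hbs, hk⟩ := h
  -- No formula in the type of `(c, b)` over `B` has `n`-inconsistent instances along `bs`;
  -- otherwise it would witness that the type of `c` divides.
  have key : ∀ (ψ : L.Formula ((ι ⊕ Fin m) ⊕ B)) (n : ℕ),
      ψ.Realize (Sum.elim (Sum.elim c b) (↑)) → ∃ I : Finset ℕ, I.card = n ∧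
        ∃ x : ι → M, ∀ i ∈ I, ψ.Realize (Sum.elim (Sum.elim x (bs i)) (↑)) := by
    intro ψ n hψ
    by_contra! hcon
    have hr : ∀ (x : ι → M) (y : Fin m → M),
        (ψ.relabel (Equiv.sumAssoc ι (Fin m) B)).Realize
          (Sum.elim x (Sum.elim y ((↑) : B → M))) ↔
        ψ.Realize (Sum.elim (Sum.elim x y) (↑)) := by
      intro x y
      rw [Formula.realize_relabel]
      apply iff_of_eq
      congr 1
      funext p
      rcases p with (p | p) | p <;> rfl
    refine hc (Divides.of_formula (ψ.relabel (Equiv.sumAssoc ι (Fin m) B)) n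
      (Sum.elim b (↑)) (fun i => Sum.elim (bs i) (↑)) ?_ ((hr _ _).2 hψ)
      (fun i => (hbs i).of_comp ?_) ?_)
    · rintro (r | r)
      · exact hb r
      · exact hBB' r.2
    · rintro ((r | r) | r)
      · exact ⟨Sum.inl r, rfl, rfl⟩
      · exact ⟨Sum.inr r, rfl, rfl⟩
      · exact ⟨Sum.inr r, rfl, rfl⟩
    · simp only [hr]
      rintro I hI ⟨x, hx⟩
      obtain ⟨i, hi, hn⟩ := hcon I hI x
      exact hn (hx i hi)
  let Ψ := {ψ : L.Formula ((ι ⊕ Fin m) ⊕ B) // ψ.Realize (Sum.elim (Sum.elim c b) (↑))}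
  have key' : ∀ X : Finset Ψ × ℕ, ∃ (x : ι → M) (σ : ℕ → ℕ), InjOn σ (Iio X.2) ∧
      ∀ i < X.2, ∀ ψ ∈ X.1, ψ.1.Realize (Sum.elim (Sum.elim x (bs (σ i))) (↑)) := by
    rintro ⟨G, n⟩
    obtain ⟨I, hI, x, hx⟩ := key (Formula.iInf fun ψ : G => ψ.1.1) n
      (Formula.realize_iInf.2 fun ψ => ψ.1.2)
    refine ⟨x, fun i => if hi : i < n then I.orderEmbOfFin hI ⟨i, hi⟩ else 0, ?_, ?_⟩
    · intro i hi j hj hij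
      simp only [mem_Iio] at hi hj
      simpa [hi, hj] using hij
    · intro i hi ψ hψ
      simp only at hi
      simpa [hi] using Formula.realize_iInf.1
        (hx _ (I.orderEmbOfFin_mem hI ⟨i, hi⟩)) ⟨ψ, hψ⟩
  choose x σ hσ hx using key'
  let U : Ultrafilter (Finset Ψ × ℕ) := Ultrafilter.of Filter.atTop
  have hU : ∀ {p : Finset Ψ × ℕ → Prop} (X₀ : Finset Ψ × ℕ), (∀ X ≥ X₀, p X) →
      ∀ᶠ X in U, p X := fun X₀ h =>
    Ultrafilter.of_le Filter.atTop (Filter.eventually_atTop.2 ⟨X₀, h⟩)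
  -- By compactness, one copy of `c` and an infinite sequence of copies of `b`, each forming with
  -- that same copy of `c` a tuple of the type of `(c, b)` over `B`. Injectivity of `σ` preserves
  -- `k`-inconsistency.
  obtain ⟨w, hw⟩ := hM.exists_realization U (V := ι ⊕ (ℕ × Fin m))
    (fun X => Sum.elim (x X) fun p => bs (σ X p.1) p.2) ((↑) : B → M)
  have h1 : ∀ i, EqTp L (Sum.elim (Sum.elim c b) ((↑) : B → M))
      (Sum.elim (Sum.elim (w ∘ Sum.inl) (fun r => w (Sum.inr (i, r)))) (↑)) := by
    refine fun i => EqTp.of_imp fun ψ hψ => ?_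
    have hr : ∀ (w : ι ⊕ (ℕ × Fin m) → M), (ψ.relabel (Sum.map
        (Sum.map id fun r => (i, r)) id)).Realize (Sum.elim w ((↑) : B → M)) ↔
        ψ.Realize (Sum.elim (Sum.elim (w ∘ Sum.inl) (fun r => w (Sum.inr (i, r)))) (↑)) := by
      intro w
      rw [Formula.realize_relabel]
      apply iff_of_eq
      congr 1
      funext p
      rcases p with (p | p) | p <;> rfl
    rw [← hr]
    refine hw _ (hU ({⟨ψ, hψ⟩}, i + 1) fun X hX => ?_)
    rw [hr]
    exact hx X i hX.2 ⟨ψ, hψ⟩ (hX.1 (Finset.mem_singleton_self _))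
  have h2 : ∀ I : Finset ℕ, I.card = k → ¬ ∃ z : ι ⊕ κ → M, ∀ i ∈ I,
      φ.Realize (Sum.elim z fun r => w (Sum.inr (i, r))) := by
    intro I hI
    obtain ⟨ψ, hψ⟩ := exists_formula_inconsistent (M := M) (I := I)
      (V := (ι ⊕ (ℕ × Fin m)) ⊕ B) φ
      (fun i r => Sum.inl (Sum.inr (i.1, r))) (Sum.elim c d)
    rintro ⟨z, hz⟩
    refine (hψ _).1 (hw ψ (hU (∅, I.sup id + 1) fun X hX => (hψ _).2 ?_)) ⟨z, fun i => hz i i.2⟩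
    rintro ⟨z, hz⟩
    have hIX : ∀ i ∈ I, i ∈ Iio X.2 := fun i hi =>
      (Nat.lt_succ_of_le (Finset.le_sup (f := id) hi)).trans_le hX.2
    refine hk (I.image (σ X)) ?_ ⟨z, fun i hi => ?_⟩
    · rw [Finset.card_image_of_injOn ((hσ X).mono hIX), hI]
    · obtain ⟨j, hj, rfl⟩ := Finset.mem_image.1 hi
      exact hz ⟨j, hj⟩
  have h3 : EqTp L (Sum.elim (w ∘ Sum.inl) ((↑) : B → M)) (Sum.elim c (↑)) := by
    refine (h1 0).symm.of_comp ?_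
    rintro (r | r)
    · exact ⟨Sum.inl (Sum.inl r), rfl, rfl⟩
    · exact ⟨Sum.inr r, rfl, rfl⟩
  -- Moving the copy of `c` back to `c` over `B` turns the sequence into one of tuples with the type
  -- of `b` over `B` and `c`.
  obtain ⟨g, hg⟩ := hM.exists_equiv h3
  have hgc : ∀ a, g (w (Sum.inl a)) = c a := fun a => hg (Sum.inl a)
  have hgB : ∀ a : B, g a = a := fun a => hg (Sum.inr a)
  have h4 : ∀ i, EqTp L (Sum.elim (Sum.elim c fun r => g (w (Sum.inr (i, r)))) ((↑) : B → M))
      (Sum.elim (Sum.elim c b) (↑)) := by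
    intro i
    refine ((EqTp.of_equiv g _).symm.trans (h1 i).symm).of_comp ?_
    rintro ((r | r) | r)
    · exact ⟨Sum.inl (Sum.inl r), (hgc r).symm, rfl⟩
    · exact ⟨Sum.inl (Sum.inr r), rfl, rfl⟩
    · exact ⟨Sum.inr r, (hgB r).symm, rfl⟩
  let f : (ι ⊕ κ) ⊕ Fin m → κ ⊕ (ι ⊕ Fin m) := Sum.elim
    (Sum.elim (fun a => Sum.inr (Sum.inl a)) Sum.inl) (fun r => Sum.inr (Sum.inr r))
  have hr : ∀ (z : κ → M) (y : Fin m → M), (φ.relabel f).Realize (Sum.elim z (Sum.elim c y)) ↔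
      φ.Realize (Sum.elim (Sum.elim c z) y) := by
    intro z y
    rw [Formula.realize_relabel]
    apply iff_of_eq
    congr 1
    funext p
    rcases p with (p | p) | p <;> rfl
  refine Divides.of_formula (φ.relabel f) k (Sum.elim c b)
    (fun i => Sum.elim c fun r => g (w (Sum.inr (i, r)))) ?_ ((hr _ _).2 hφ)
    (fun i => (h4 i).of_comp ?_) ?_
  · rintro (r | r)
    · exact Or.inr ⟨r, rfl⟩
    · exact Or.inl (hb r)
  · rintro (r | ⟨r, hr | ⟨a, rfl⟩⟩)
    · exact ⟨Sum.inl r, rfl, rfl⟩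
    · exact ⟨Sum.inr ⟨r, hr⟩, rfl, rfl⟩
    · exact ⟨Sum.inl (Sum.inl a), rfl, rfl⟩
  · rintro I hI ⟨z, hz⟩
    refine h2 I hI ⟨g.symm ∘ Sum.elim c z, fun i hi => ?_⟩
    have := (hr _ _).1 (hz i hi)
    rw [← StrongHomClass.realize_formula g.symm] at this
    convert this using 1
    funext p
    rcases p with p | p
    · rfl
    · simp

variable (L) in
/-- A chain, indexed by `W`, of small sets containing `A` such that the type of `c` divides
infinitely often along it. -/
def HasDividingChain {ι : Type u} (A : Set M) (c : ι → M) (W : Type*) [LT W] : Prop :=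
  ∃ B B' : W → Set M, (∀ j, Small.{u} (B' j)) ∧ (∀ j, A ⊆ B j) ∧ (∀ j, B j ⊆ B' j) ∧
    (∀ j j', j < j' → B' j ⊆ B j') ∧ ∀ j, Divides L c (B j) (B' j)

/-- A dividing chain for a pair splits into a dividing chain for each of its components. -/
theorem HasDividingChain.exists_split (hM : IsMonster L M) {ι κ : Type u} {c : ι → M} {d : κ → M}
    {A : Set M} {W : Type*} [LT W] (h : HasDividingChain L A (Sum.elim c d) W) :
    ∃ s : Set W, HasDividingChain L A c s ∧ HasDividingChain L A d ↑sᶜ := by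
  obtain ⟨B, B', hB', hA, hBB', hlt, hdiv⟩ := h
  -- The steps at which the type of `c` does not divide are left to `d`, over the sets enlarged by
  -- `c`.
  refine ⟨{j | Divides L c (B j) (B' j)},
    ⟨fun j => B j, fun j => B' j, fun j => hB' j, fun j => hA j, fun j => hBB' j,
      fun j j' h => hlt _ _ h, fun j => j.2⟩,
    ⟨fun j => B j ∪ range c, fun j => B' j ∪ range c, fun j => ?_,
      fun j => (hA j).trans subset_union_left, fun j => union_subset_union_left _ (hBB' j),
      fun j j' h => union_subset_union_left _ (hlt _ _ h), fun j => ?_⟩⟩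
  · have := hB' j
    exact small_union _ _
  · have := hB' j
    have : Small.{u} (B j) := small_subset (hBB' j)
    exact (Divides.or_of_sum hM (hBB' j) (hdiv j)).resolve_left j.2

end Dividing

/-! ### Dividing trees and dividing chains are equivalent -/

section Trees

variable {L : FirstOrder.Language.{u, u}} {M : Type v} [L.Structure M]

/-- A type-definable set is given by formulas with a small tuple of parameters. -/
theorem IsTypeDefinable.exists_formulas {ι : Type u} {S : Set (ι → M)}
    (h : IsTypeDefinable L S) : ∃ (P : Type u) (p : P → M) (Φ : Set (L.Formula (ι ⊕ P))),
      ∀ x, x ∈ S ↔ ∀ φ ∈ Φ, φ.Realize (Sum.elim x p) := by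
  obtain ⟨A, hA, F, hF, rfl⟩ := h
  let p : Shrink.{u} A → M := fun a => ((equivShrink A).symm a : M)
  refine ⟨Shrink.{u} A, p, {φ | {x | φ.Realize (Sum.elim x p)} ∈ F}, fun x => ?_⟩
  refine ⟨fun hx φ hφ => hx _ hφ, fun hx X hX => ?_⟩
  obtain ⟨φ, rfl⟩ := definable_iff_exists_formula_sum.1 (hF X hX)
  have key : ∀ x : ι → M, (φ.relabel (Sum.elim (fun a => Sum.inr (equivShrink A a))
      Sum.inl)).Realize (Sum.elim x p) ↔ φ.Realize (Sum.elim (↑) x) := by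
    intro x
    rw [Formula.realize_relabel]
    apply iff_of_eq
    congr 1
    funext r
    rcases r with r | r <;> simp [p]
  have := hx (φ.relabel (Sum.elim (fun a => Sum.inr (equivShrink A a)) Sum.inl)) (by
    simp only [mem_ofPred_eq, key]
    exact hX)
  exact (key x).1 this

variable (L) in
/-- There is a dividing tree in `S` with levels indexed by the order `W`. The nodes on level `j`
are indexed by functions on all of `W`, of which only the part below `j` matters. -/
def HasTreeOn {ι : Type u} (S : Set (ι → M)) (W : Type*) [LT W] : Prop :=
  ∃ (k : W → ℕ) (D : W → (W → ℕ) → ℕ → Set (ι → M)),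
    (∀ j, ∃ (m : ℕ) (φ : L.Formula (ι ⊕ Fin m)), ∀ f i, ∃ a : Fin m → M,
      D j f i = {x | φ.Realize (Sum.elim x a)}) ∧
    (∀ j f f', (∀ l < j, f l = f' l) → D j f = D j f') ∧
    (∀ j f (I : Finset ℕ), I.card = k j → ¬ ∃ x, ∀ i ∈ I, x ∈ D j f i) ∧
    ∀ f : W → ℕ, ∃ x ∈ S, ∀ j, x ∈ D j f (f j)

/-- A dividing tree gives rise to a dividing chain: widen the branching until, by the pigeonhole
principle, there is a branch that can be left to infinitely many nodes of the same type. -/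
theorem HasTreeOn.exists_chain (hM : IsMonster L M) {ι P : Type u} {S : Set (ι → M)} {p : P → M}
    {Φ : Set (L.Formula (ι ⊕ P))} (hS : ∀ x, x ∈ S ↔ ∀ φ ∈ Φ, φ.Realize (Sum.elim x p))
    {W : Type u} [LinearOrder W] [WellFoundedLT W] (h : HasTreeOn L S W) :
    ∃ c ∈ S, HasDividingChain L (range p) c W := by
  classical
  obtain ⟨k, D, hD, hloc, hk, hbr⟩ := h
  choose m φ a₀ ha₀ using hD
  -- The sets `D j f i` depend on `f` below `j` only, but the parameters chosen for them need not;
  -- truncating `f` restores this.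
  let trunc : W → (W → ℕ) → W → ℕ := fun j f l => if l < j then f l else 0
  have htrunc : ∀ j f f', (∀ l < j, f l = f' l) → trunc j f = trunc j f' := by
    intro j f f' hff
    funext l
    by_cases hl : l < j
    · simp [trunc, hl, hff l hl]
    · simp [trunc, hl]
  let a : ∀ j : W, (W → ℕ) → ℕ → Fin (m j) → M := fun j f i => a₀ j (trunc j f) i
  have ha : ∀ j f i x, x ∈ D j f i ↔ (φ j).Realize (Sum.elim x (a j f i)) := by
    intro j f i x
    rw [hloc j f (trunc j f) (fun l hl => by simp [trunc, hl]), ha₀]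
    rfl
  have haloc : ∀ j f f', (∀ l < j, f l = f' l) → a j f = a j f' := fun j f f' hff => by
    simp only [a, htrunc j f f' hff]
  simp only [ha] at hk hbr
  choose x hxS hx using hbr
  -- `Θ` has room for every type of a level's parameters over `p` and the earlier parameters; the
  -- summand `ℕ` makes it infinite for the pigeonhole principle. Its power set `Λ` is strictly
  -- larger and labels the widened branching.
  let Θ : Type u := (Σ j : W, Set (L.Formula (Fin (m j) ⊕ (P ⊕ Σ l : Iio j, Fin (m l))))) ⊕ ℕ
  let Λ : Type u := Set Θ
  choose h hh using fun F : Finset Λ => countable_iff_exists_injOn.1 F.countable_toSet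
  let U : Ultrafilter (Finset Λ) := Ultrafilter.of Filter.atTop
  have hU : ∀ {p : Finset Λ → Prop} (X₀ : Finset Λ), (∀ X ≥ X₀, p X) →
      ∀ᶠ X in U, p X := fun X₀ h =>
    Ultrafilter.of_le Filter.atTop (Filter.eventually_atTop.2 ⟨X₀, h⟩)
  let V : Type u := (Σ j : W, (W → Λ) × Λ × Fin (m j)) ⊕ ((W → Λ) × ι)
  -- The approximation at `F` reads the given tree through `h F`, which keeps the labels in `F`
  -- distinct. The variables are all parameters and all branch realizations of the widened tree.
  let e : Finset Λ → V → M := fun F => Sum.elim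
    (fun q => a q.1 (h F ∘ q.2.1) (h F q.2.2.1) q.2.2.2) (fun q => x (h F ∘ q.1) q.2)
  obtain ⟨w, hw⟩ := hM.exists_realization U e p
  let A : ∀ j : W, (W → Λ) → Λ → Fin (m j) → M := fun j f i r => w (Sum.inl ⟨j, f, i, r⟩)
  let y : (W → Λ) → ι → M := fun f t => w (Sum.inr (f, t))
  have hAloc : ∀ j f f', (∀ l < j, f l = f' l) → A j f = A j f' := by
    intro j f f' hff
    funext i r
    have := hw ((Term.var (Sum.inl (Sum.inl ⟨j, f, i, r⟩))).equal
      (Term.var (Sum.inl (Sum.inl ⟨j, f', i, r⟩)))) (hU ∅ fun F _ => by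
        simp only [Formula.realize_equal, Term.realize_var, Sum.elim_inl, e]
        rw [haloc j (h F ∘ f) (h F ∘ f') fun l hl => by simp [hff l hl] ])
    simpa [Formula.realize_equal] using this
  have hAk : ∀ j f (I : Finset Λ), I.card = k j → ¬ ∃ z : ι → M, ∀ i ∈ I,
      (φ j).Realize (Sum.elim z (A j f i)) := by
    rintro j f I hI ⟨z, hz⟩
    obtain ⟨ψ, hψ⟩ := exists_formula_inconsistent (M := M) (I := I) (V := V ⊕ P) (φ j)
      (fun i r => Sum.inl (Sum.inl ⟨j, f, i.1, r⟩)) z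
    refine (hψ _).1 (hw ψ (hU I fun F hF => (hψ _).2 ?_)) ⟨z, fun i => hz i i.2⟩
    rintro ⟨z, hz⟩
    refine hk j (h F ∘ f) (I.image (h F)) ?_ ⟨z, fun i hi => ?_⟩
    · rw [Finset.card_image_of_injOn ((hh F).mono hF), hI]
    · obtain ⟨i', hi', rfl⟩ := Finset.mem_image.1 hi
      exact hz ⟨i', hi'⟩
  have hyA : ∀ f j, (φ j).Realize (Sum.elim (y f) (A j f (f j))) := by
    intro f j
    let r : ι ⊕ Fin (m j) → V ⊕ P := Sum.elim (fun t => Sum.inl (Sum.inr (f, t)))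
      (fun r => Sum.inl (Sum.inl ⟨j, f, f j, r⟩))
    have hr : ∀ w : V → M, ((φ j).relabel r).Realize (Sum.elim w p) ↔
        (φ j).Realize (Sum.elim (fun t => w (Sum.inr (f, t)))
          (fun r => w (Sum.inl ⟨j, f, f j, r⟩))) := by
      intro w
      rw [Formula.realize_relabel]
      apply iff_of_eq
      congr 1
      funext q
      rcases q with q | q <;> rfl
    exact (hr w).1 (hw _ (hU ∅ fun F _ => (hr _).2 (hx (h F ∘ f) j)))
  have hyS : ∀ f, y f ∈ S := by
    intro f
    rw [hS]
    intro φ hφ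
    let r : ι ⊕ P → V ⊕ P := Sum.map (fun t => Sum.inr (f, t)) id
    have hr : ∀ w : V → M, (φ.relabel r).Realize (Sum.elim w p) ↔
        φ.Realize (Sum.elim (fun t => w (Sum.inr (f, t))) p) := by
      intro w
      rw [Formula.realize_relabel]
      apply iff_of_eq
      congr 1
      funext q
      rcases q with q | q <;> rfl
    exact (hr w).1 (hw _ (hU ∅ fun F _ => (hr _).2 ((hS _).1 (hxS (h F ∘ f)) φ hφ)))
  let q : ∀ j : W, (W → Λ) → (P ⊕ Σ l : Iio j, Fin (m l)) → M := fun j f =>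
    Sum.elim p fun s => A s.1 f (f s.1) s.2
  have hqloc : ∀ j f f', (∀ l < j, f l = f' l) → q j f = q j f' := by
    intro j f f' hff
    funext s
    rcases s with s | ⟨⟨l, hl⟩, s⟩
    · rfl
    · simp only [q, Sum.elim_inr]
      rw [hAloc l f f' fun i hi => hff i (hi.trans hl), hff l hl]
  -- At each level choose a label whose type over the earlier parameters is shared by infinitely
  -- many siblings, which will witness dividing.
  obtain ⟨f, hf⟩ : ∃ f : W → Λ, ∀ j, {i | EqTp L (Sum.elim (A j f i) (q j f))
      (Sum.elim (A j f (f j)) (q j f))}.Infinite := by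
    refine exists_forall_of_step (Y := fun _ => Λ) (fun j f i₀ => {i | EqTp L
      (Sum.elim (A j f i) (q j f)) (Sum.elim (A j f i₀) (q j f))}.Infinite) ?_ ?_
    · intro j f f' hff i₀ hi
      rwa [hAloc j f f' hff, hqloc j f f' hff] at hi
    · intro j f _
      let τ : Λ → Θ := fun i => Sum.inl ⟨j, {ψ | ψ.Realize (Sum.elim (A j f i) (q j f))}⟩
      obtain ⟨t, ht⟩ := Cardinal.exists_infinite_fiber' τ
        (by rw [Cardinal.mk_set]; exact Cardinal.cantor _)
      have ht : (τ ⁻¹' {t}).Infinite := infinite_coe_iff.1 ht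
      obtain ⟨i₀, hi₀⟩ := ht.nonempty
      refine ⟨i₀, ht.mono fun i hi ψ => ?_⟩
      have hτ : τ i = τ i₀ := (show τ i = t from hi).trans (show τ i₀ = t from hi₀).symm
      exact Set.ext_iff.1 (eq_of_heq (Sigma.mk.inj (Sum.inl.inj hτ)).2) ψ
  refine ⟨y f, hyS f, fun j => range (q j f), fun j => range (q j f) ∪ range (A j f (f j)),
    fun j => small_union _ _, fun j => ?_, fun j => subset_union_left, ?_, fun j => ?_⟩
  · rintro _ ⟨s, rfl⟩
    exact ⟨Sum.inl s, rfl⟩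
  · rintro j j' hj _ (⟨s | ⟨l, s⟩, rfl⟩ | ⟨s, rfl⟩)
    · exact ⟨Sum.inl s, rfl⟩
    · exact ⟨Sum.inr ⟨⟨l, (mem_Iio.1 l.2).trans hj⟩, s⟩, rfl⟩
    · exact ⟨Sum.inr ⟨⟨j, hj⟩, s⟩, rfl⟩
  · let E := (hf j).natEmbedding
    refine ⟨m j, φ j, k j, A j f (f j), fun n => A j f (E n), fun r => Or.inr ⟨r, rfl⟩,
      hyA f j, fun n => ?_, fun I hI => ?_⟩
    · refine EqTp.of_comp (E n).2 ?_
      rintro (r | ⟨_, r, rfl⟩)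
      · exact ⟨Sum.inl r, rfl, rfl⟩
      · exact ⟨Sum.inr r, rfl, rfl⟩
    · rintro ⟨z, hz⟩
      refine hAk j f (I.map (E.trans (Function.Embedding.subtype _))) (by simpa using hI)
        ⟨z, fun i hi => ?_⟩
      obtain ⟨n, hn, rfl⟩ := Finset.mem_map.1 hi
      exact hz n hn

/-- A dividing chain gives rise to a dividing tree. -/
theorem HasDividingChain.hasTreeOn (hM : IsMonster L M) {ι P : Type u} {S : Set (ι → M)}
    {p : P → M} {Φ : Set (L.Formula (ι ⊕ P))}
    (hS : ∀ x, x ∈ S ↔ ∀ φ ∈ Φ, φ.Realize (Sum.elim x p))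
    {W : Type u} [LinearOrder W] [WellFoundedLT W] {c : ι → M} (hc : c ∈ S)
    (h : HasDividingChain L (range p) c W) : HasTreeOn L S W := by
  classical
  obtain ⟨B, B', -, hpB, -, hlt, hdiv⟩ := h
  choose m φ k b bs hb hφ hbs hk using hdiv
  let q : ∀ s : Set W, (∀ l : W, Fin (m l) → M) → (P ⊕ Σ l : s, Fin (m l)) → M :=
    fun s t => Sum.elim p fun r => t r.1 r.2
  -- A formula mentions finitely many levels, so equality of types may be checked up to the largest
  -- of them; this covers limit stages.
  have hlim : ∀ (s : Set W) (t : ∀ l : W, Fin (m l) → M),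
      (∀ l ∈ s, EqTp L (q (Iic l) b) (q (Iic l) t)) → EqTp L (q s b) (q s t) := by
    intro s t hst
    refine EqTp.of_finite fun T => ?_
    rcases (T.toRight.image fun r => r.1.1).eq_empty_or_nonempty with h0 | h0
    · rw [Finset.image_eq_empty] at h0
      have : (fun r : T => q s b r) = fun r : T => q s t r := by
        funext ⟨r, hr⟩
        rcases r with r | r
        · rfl
        · rw [← Finset.mem_toRight, h0] at hr
          exact absurd hr (Finset.notMem_empty _)
      rw [this]
      exact fun _ => Iff.rfl
    · obtain ⟨r₀, -, hr₀⟩ := Finset.mem_image.1 (Finset.max'_mem _ h0)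
      refine (hst _ r₀.1.2).of_comp ?_
      rintro ⟨r | ⟨l, r⟩, hr⟩
      · exact ⟨Sum.inl r, rfl, rfl⟩
      · refine ⟨Sum.inr ⟨⟨l, ?_⟩, r⟩, rfl, rfl⟩
        rw [mem_Iic, hr₀]
        exact Finset.le_max' _ _ (Finset.mem_image_of_mem
          (fun r : Σ l : s, Fin (m l) => r.1.1) (Finset.mem_toRight.2 hr))
  let G : ∀ _ : W, (∀ l : W, Fin (m l) → M) → (M ≃[L] M) → Prop := fun j t g =>
    (∀ r, g (p r) = p r) ∧ ∀ l < j, ∀ r, g (b l r) = t l r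
  -- If an automorphism over `p` carries the earlier `b l` to the parameters `t l` chosen so far,
  -- the children are the images of `bs j`. The default `b j` never occurs along a branch, by
  -- `hgood`.
  let next : ∀ j : W, (∀ l : W, Fin (m l) → M) → ℕ → Fin (m j) → M := fun j t i =>
    if h : ∃ g, G j t g then h.choose ∘ bs j i else b j
  have hnext : ∀ j t t', (∀ l < j, t l = t' l) → next j t = next j t' := by
    intro j t t' htt
    have : G j t = G j t' := by
      funext g
      simp only [G]
      refine congrArg _ (propext (forall₂_congr fun l hl => ?_))
      rw [htt l hl]
    simp only [next, this]
  have ht : ∀ f : W → ℕ, ∃ t : ∀ l : W, Fin (m l) → M, ∀ j, t j = next j t (f j) := by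
    intro f
    have : ∀ j : W, Nonempty (Fin (m j) → M) := fun j => ⟨b j⟩
    refine exists_forall_of_step (fun j t y => y = next j t (f j)) ?_ fun j t _ => ⟨_, rfl⟩
    intro j t t' htt y hy
    rwa [← hnext j t t' htt]
  choose t ht using ht
  have htloc : ∀ (f f' : W → ℕ) j, (∀ l < j, f l = f' l) → ∀ l < j, t f l = t f' l := by
    intro f f' j hff l
    induction l using WellFoundedLT.induction with
    | ind l ih =>
      intro hl
      rw [ht f, ht f', hff l hl, hnext l _ _ fun i hi => ih i hi (hi.trans hl)]
  have hG : ∀ s f, EqTp L (q s b) (q s (t f)) →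
      ∃ g : M ≃[L] M, (∀ r, g (p r) = p r) ∧ ∀ l ∈ s, ∀ r, g (b l r) = t f l r := by
    intro s f hs
    obtain ⟨g, hg⟩ := hM.exists_equiv hs
    exact ⟨g, fun r => hg (Sum.inl r), fun l hl r => hg (Sum.inr ⟨⟨l, hl⟩, r⟩)⟩
  have hgood : ∀ f j, EqTp L (q (Iic j) b) (q (Iic j) (t f)) := by
    intro f j
    induction j using WellFoundedLT.induction with
    | ind j ih =>
      have hex : ∃ g, G j (t f) g := hG (Iio j) f (hlim _ _ fun l hl => ih l hl)
      have htj : t f j = hex.choose ∘ bs j (f j) := by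
        rw [ht f j]
        simp only [next, hex, dif_pos]
      obtain ⟨hgp, hgb⟩ := hex.choose_spec
      -- `bs j (f j)` has the type of `b j` over `B j`, which contains `p` and all earlier `b l`;
      -- then the automorphism is applied.
      refine ((hbs j (f j)).symm.trans (EqTp.of_equiv hex.choose _)).of_comp ?_
      rintro (r | ⟨⟨l, hl⟩, r⟩)
      · exact ⟨Sum.inr ⟨p r, hpB j ⟨r, rfl⟩⟩, rfl, (hgp r).symm⟩
      · rcases (mem_Iic.1 hl).eq_or_lt with rfl | hl
        · exact ⟨Sum.inl r, rfl, by simp [q, htj]⟩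
        · exact ⟨Sum.inr ⟨b l r, hlt l j hl (hb l r)⟩, rfl, (hgb l hl r).symm⟩
  refine ⟨k, fun j f i => {x | (φ j).Realize (Sum.elim x (next j (t f) i))},
    fun j => ⟨m j, φ j, fun f i => ⟨_, rfl⟩⟩, fun j f f' hff => ?_, fun j f I hI => ?_,
    fun f => ?_⟩
  · simp only [hnext j _ _ (htloc f f' j hff)]
  · have hex : ∃ g, G j (t f) g := hG (Iio j) f (hlim _ _ fun l _ => hgood f l)
    rintro ⟨x, hx⟩
    refine hk j I hI ⟨hex.choose.symm ∘ x, fun i hi => ?_⟩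
    have := hx i hi
    simp only [next, hex, dif_pos, mem_ofPred_eq] at this
    rw [← StrongHomClass.realize_formula hex.choose.symm] at this
    convert this using 1
    funext r
    rcases r with r | r
    · rfl
    · simp
  -- One automorphism carries all the `b l` to the whole branch. It fixes `p`, so `g ∘ c` stays in
  -- `S`.
  · obtain ⟨g, hgp, hgb⟩ := hG univ f (hlim _ _ fun l _ => hgood f l)
    refine ⟨g ∘ c, (hS _).2 fun ψ hψ => ?_, fun j => ?_⟩
    · have := (hS c).1 hc ψ hψ
      rw [← StrongHomClass.realize_formula g] at this
      convert this using 1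
      funext r
      rcases r with r | r
      · rfl
      · exact (hgp r).symm
    · have := hφ j
      rw [← StrongHomClass.realize_formula g] at this
      rw [mem_ofPred_eq, ← ht f j]
      convert this using 1
      funext r
      rcases r with r | r
      · rfl
      · exact (hgb j (mem_univ j) r).symm

end Trees

/-! ### Sums and splittings of tree depths -/

section Depths

variable {L : FirstOrder.Language.{u, u}} {M : Type v} [L.Structure M]

theorem hasDividingTree_iff {ι : Type u} {S : Set (ι → M)} {α : Ordinal.{u}} :
    HasDividingTree L S α ↔ HasTreeOn L S (Iio α) := by
  constructor
  · rintro ⟨m, φ, k, a, hk, hbr⟩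
    refine ⟨k, fun j f i => {x | (φ j).Realize (Sum.elim x
      (a j (fun l => f ⟨l.1, (mem_Iio.1 l.2).trans j.2⟩) i))}, fun j => ⟨m j, φ j, fun f i =>
      ⟨_, rfl⟩⟩, fun j f f' hff => ?_, fun j f I hI => hk j _ I hI, fun f => hbr f⟩
    have : (fun l : Iio j.1 => f ⟨l.1, (mem_Iio.1 l.2).trans j.2⟩) =
        fun l : Iio j.1 => f' ⟨l.1, (mem_Iio.1 l.2).trans j.2⟩ :=
      funext fun l => hff _ l.2
    simp only [this]
  · classical
    rintro ⟨k, D, hD, hloc, hk, hbr⟩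
    choose m φ a ha using hD
    let ext : ∀ j : Iio α, (Iio j.1 → ℕ) → Iio α → ℕ := fun j s l =>
      if h : l.1 < j.1 then s ⟨l.1, h⟩ else 0
    refine ⟨m, φ, k, fun j s i => a j (ext j s) i, fun j s I hI => ?_, fun f => ?_⟩
    · have := hk j (ext j s) I hI
      simpa only [ha, mem_ofPred_eq] using this
    · obtain ⟨x, hxS, hx⟩ := hbr f
      refine ⟨x, hxS, fun j => ?_⟩
      have := hx j
      rw [hloc j f (ext j fun l => f ⟨l.1, (mem_Iio.1 l.2).trans j.2⟩) fun l hl => by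
        dsimp only [ext]
        rw [dif_pos (show l.1 < j.1 from hl)], ha] at this
      exact this

theorem HasTreeOn.comp {ι : Type u} {S : Set (ι → M)} {W W' : Type*} [LinearOrder W]
    [LinearOrder W'] (h : HasTreeOn L S W) {e : W' → W} (he : StrictMono e) :
    HasTreeOn L S W' := by
  obtain ⟨k, D, hD, hloc, hk, hbr⟩ := h
  refine ⟨fun j => k (e j), fun j f => D (e j) (Function.extend e f 0), fun j => ?_,
    fun j f f' hff => hloc _ _ _ fun l hl => ?_, fun j f => hk _ _, fun f => ?_⟩
  · obtain ⟨m, φ, h⟩ := hD (e j)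
    exact ⟨m, φ, fun f i => h _ _⟩
  · by_cases hr : ∃ l', e l' = l
    · obtain ⟨l', rfl⟩ := hr
      rw [he.injective.extend_apply, he.injective.extend_apply, hff _ (he.lt_iff_lt.1 hl)]
    · rw [Function.extend_apply' _ _ _ hr, Function.extend_apply' _ _ _ hr]
  · obtain ⟨x, hxS, hx⟩ := hbr (Function.extend e f 0)
    refine ⟨x, hxS, fun j => ?_⟩
    simpa only [he.injective.extend_apply] using hx (e j)

/-- Putting a dividing tree in `T` on top of a dividing tree in `S`. -/
theorem HasTreeOn.sumLex {ι κ η : Type u} {S : Set (ι → M)} {T : Set (κ → M)} {R : Set (η → M)}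
    (r : ι → η) (r' : κ → η) (hR : ∀ x ∈ S, ∀ y ∈ T, ∃ z ∈ R, z ∘ r = x ∧ z ∘ r' = y)
    {W W' : Type*} [LinearOrder W] [LinearOrder W'] (h : HasTreeOn L S W)
    (h' : HasTreeOn L T W') : HasTreeOn L R (W ⊕ₗ W') := by
  obtain ⟨k, D, hD, hloc, hk, hbr⟩ := h
  obtain ⟨k', D', hD', hloc', hk', hbr'⟩ := h'
  -- The parameters of the upper tree ignore the labels of the lower one, so both branches are
  -- realized independently and joined by `hR`.
  refine ⟨fun j => Sum.elim k k' (ofLex j), fun j f i => Sum.elim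
    (fun j => {z | z ∘ r ∈ D j (fun l => f (Sum.inlₗ l)) i})
    (fun j => {z | z ∘ r' ∈ D' j (fun l => f (Sum.inrₗ l)) i}) (ofLex j), ?_, ?_, ?_, ?_⟩
  · intro j
    induction j using Lex.rec with
    | _ j =>
      rcases j with j | j
      · obtain ⟨m, φ, h⟩ := hD j
        refine ⟨m, φ.relabel (Sum.map r id), fun f i => ?_⟩
        obtain ⟨a, ha⟩ := h (fun l => f (Sum.inlₗ l)) i
        refine ⟨a, ?_⟩
        ext z
        simp [ha, Formula.realize_relabel, Sum.elim_comp_map]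
      · obtain ⟨m, φ, h⟩ := hD' j
        refine ⟨m, φ.relabel (Sum.map r' id), fun f i => ?_⟩
        obtain ⟨a, ha⟩ := h (fun l => f (Sum.inrₗ l)) i
        refine ⟨a, ?_⟩
        ext z
        simp [ha, Formula.realize_relabel, Sum.elim_comp_map]
  · intro j f f' hff
    induction j using Lex.rec with
    | _ j =>
      funext i
      rcases j with j | j
      · have := hloc j (fun l => f (Sum.inlₗ l)) (fun l => f' (Sum.inlₗ l))
          fun l hl => hff _ (Sum.Lex.inl_lt_inl_iff.2 hl)
        simp [this]
      · have := hloc' j (fun l => f (Sum.inrₗ l)) (fun l => f' (Sum.inrₗ l))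
          fun l hl => hff _ (Sum.Lex.inr_lt_inr_iff.2 hl)
        simp [this]
  · intro j f I hI
    induction j using Lex.rec with
    | _ j =>
      rcases j with j | j
      · rintro ⟨z, hz⟩
        exact hk j _ I hI ⟨z ∘ r, hz⟩
      · rintro ⟨z, hz⟩
        exact hk' j _ I hI ⟨z ∘ r', hz⟩
  · intro f
    obtain ⟨x, hxS, hx⟩ := hbr fun l => f (Sum.inlₗ l)
    obtain ⟨y, hyT, hy⟩ := hbr' fun l => f (Sum.inrₗ l)
    obtain ⟨z, hzR, rfl, rfl⟩ := hR x hxS y hyT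
    refine ⟨z, hzR, fun j => ?_⟩
    induction j using Lex.rec with
    | _ j =>
      rcases j with j | j
      · exact hx j
      · exact hy j

theorem HasDividingTree.mono {ι : Type u} {S : Set (ι → M)} {α β : Ordinal.{u}} (hβ : β ≤ α)
    (h : HasDividingTree L S α) : HasDividingTree L S β :=
  hasDividingTree_iff.2 ((hasDividingTree_iff.1 h).comp
    (e := fun j : Iio β => (⟨j.1, j.2.trans_le hβ⟩ : Iio α)) fun _ _ h => h)

theorem hasDividingTree_zero {ι : Type u} {S : Set (ι → M)} (h : S.Nonempty) :
    HasDividingTree L S 0 := by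
  have hE : IsEmpty (Iio (0 : Ordinal.{u})) := ⟨fun j => (mem_Iio.1 j.2).not_ge zero_le⟩
  obtain ⟨x, hx⟩ := h
  exact hasDividingTree_iff.2 ⟨fun _ => 0, fun _ _ _ => univ, fun j => hE.elim j,
    fun j => hE.elim j, fun j => hE.elim j, fun _ => ⟨x, hx, fun j => hE.elim j⟩⟩

/-- The coordinate maps `r` and `r'` are left abstract so that exchanging them gives the sum in the
other order. -/
theorem HasDividingTree.add {ι κ η : Type u} {S : Set (ι → M)} {T : Set (κ → M)}
    {R : Set (η → M)} (r : ι → η) (r' : κ → η)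
    (hR : ∀ x ∈ S, ∀ y ∈ T, ∃ z ∈ R, z ∘ r = x ∧ z ∘ r' = y) {α β : Ordinal.{u}}
    (h : HasDividingTree L S α) (h' : HasDividingTree L T β) :
    HasDividingTree L R (α + β) := by
  classical
  refine hasDividingTree_iff.2 (((hasDividingTree_iff.1 h).sumLex r r' hR
    (hasDividingTree_iff.1 h')).comp (e := fun j : Iio (α + β) =>
      if hj : j.1 < α then Sum.inlₗ ⟨j.1, hj⟩ else Sum.inrₗ ⟨j.1 - α, ?_⟩) ?_)
  · rw [mem_Iio, Ordinal.sub_lt_of_le (not_lt.1 hj)]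
    exact j.2
  · intro i j hij
    have hij : i.1 < j.1 := hij
    dsimp only
    by_cases hi : i.1 < α
    · by_cases hj : j.1 < α
      · rw [dif_pos hi, dif_pos hj]
        exact Sum.Lex.inl_lt_inl_iff.2 hij
      · rw [dif_pos hi, dif_neg hj]
        exact Sum.Lex.inl_lt_inr _ _
    · have hj : ¬ j.1 < α := fun hj => hi (hij.trans hj)
      rw [dif_neg hi, dif_neg hj]
      refine Sum.Lex.inr_lt_inr_iff.2 (Subtype.mk_lt_mk.2 ?_)
      rwa [Ordinal.sub_lt_of_le (not_lt.1 hi), Ordinal.add_sub_cancel_of_le (not_lt.1 hj)]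

theorem natSum_lt_left {α α' : Ordinal.{u}} (h : α < α') (β : Ordinal.{u}) :
    natSum α β < natSum α' β := by
  rw [natSum.eq_1 α' β]
  exact (Order.lt_succ _).trans_le ((Ordinal.le_iSup
    (fun γ : Iio α' => Order.succ (natSum γ.1 β)) ⟨α, h⟩).trans (le_max_left _ _))

theorem natSum_lt_right (α : Ordinal.{u}) {β β' : Ordinal.{u}} (h : β < β') :
    natSum α β < natSum α β' := by
  rw [natSum.eq_1 α β']
  exact (Order.lt_succ _).trans_le ((Ordinal.le_iSup
    (fun γ : Iio β' => Order.succ (natSum α γ.1)) ⟨β, h⟩).trans (le_max_right _ _))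

theorem natSum_le_natSum {α α' β β' : Ordinal.{u}} (h : α ≤ α') (h' : β ≤ β') :
    natSum α β ≤ natSum α' β' :=
  (StrictMono.monotone (fun _ _ h => natSum_lt_left h β) h).trans
    (StrictMono.monotone (fun _ _ h => natSum_lt_right α' h) h')

/-- If a well-order is split into two parts, its order type is at most the natural sum of the
order types of the parts. -/
theorem le_natSum_type {α : Ordinal.{u}} (s : Set α.ToType) :
    α ≤ natSum (Ordinal.type (α := s) (· < ·)) (Ordinal.type (α := ↑sᶜ) (· < ·)) := by
  -- If the rank of `w` exceeded `natSum ξ η`, the latter would be the rank of some `l < w`.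
  -- Induction at `l`, with the bound for the part containing `l` lowered to the rank of `l` there,
  -- makes that rank strictly smaller than itself.
  have step : ∀ w : α.ToType, ∀ ξ η : Ordinal.{u},
      (∀ l : s, l.1 < w → Ordinal.typein (α := s) (· < ·) l < ξ) →
      (∀ l : ↑sᶜ, l.1 < w → Ordinal.typein (α := ↑sᶜ) (· < ·) l < η) →
      Ordinal.typein (α := α.ToType) (· < ·) w ≤ natSum ξ η := by
    intro w
    induction w using WellFoundedLT.induction with
    | ind w ih =>
      intro ξ η hξ hη
      by_contra! hlt
      obtain ⟨l, hl⟩ := Ordinal.typein_surj (α := α.ToType) (· < ·)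
        (hlt.trans (Ordinal.typein_lt_type _ _))
      rw [← hl, Ordinal.typein_lt_typein] at hlt
      refine hl.not_lt ?_
      by_cases hs : l ∈ s
      · exact (ih l hlt _ η (fun l' hl' => (Ordinal.typein_lt_typein _).2
          (show l' < (⟨l, hs⟩ : s) from hl')) fun l' hl' => hη l' (hl'.trans hlt)).trans_lt
          (natSum_lt_left (hξ ⟨l, hs⟩ hlt) _)
      · exact (ih l hlt ξ _ (fun l' hl' => hξ l' (hl'.trans hlt)) (fun l' hl' =>
          (Ordinal.typein_lt_typein _).2 (show l' < (⟨l, hs⟩ : ↑sᶜ) from hl'))).trans_lt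
          (natSum_lt_right _ (hη ⟨l, hs⟩ hlt))
  refine le_of_forall_lt fun ξ hξ => ?_
  obtain ⟨l, rfl⟩ := Ordinal.typein_surj (α := α.ToType) (· < ·)
    (hξ.trans_eq (Ordinal.type_toType α).symm)
  by_cases hs : l ∈ s
  · exact (step l _ _ (fun l' hl' => (Ordinal.typein_lt_typein _).2
      (show l' < (⟨l, hs⟩ : s) from hl')) fun l' _ => Ordinal.typein_lt_type _ _).trans_lt
      (natSum_lt_left (Ordinal.typein_lt_type _ (⟨l, hs⟩ : s)) _)
  · exact (step l _ _ (fun l' _ => Ordinal.typein_lt_type _ _) fun l' hl' =>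
      (Ordinal.typein_lt_typein _).2 (show l' < (⟨l, hs⟩ : ↑sᶜ) from hl')).trans_lt
      (natSum_lt_right _ (Ordinal.typein_lt_type _ (⟨l, hs⟩ : ↑sᶜ)))

theorem HasTreeOn.hasDividingTree_type {ι : Type u} {S : Set (ι → M)} {W : Type u}
    [LinearOrder W] [WellFoundedLT W] (h : HasTreeOn L S W) :
    HasDividingTree L S (Ordinal.type (α := W) (· < ·)) :=
  hasDividingTree_iff.2 (h.comp (e := Ordinal.enum (α := W) (· < ·)) fun _ _ h =>
    (Ordinal.enum (α := W) (· < ·)).map_rel_iff.2 h)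

/-- A dividing tree in a product yields dividing trees in the factors whose depths have a large
natural sum. -/
theorem HasDividingTree.exists_split (hM : IsMonster L M) {ι κ : Type u} {S : Set (ι → M)}
    {T : Set (κ → M)} (hS : IsTypeDefinable L S) (hT : IsTypeDefinable L T) {α : Ordinal.{u}}
    (h : HasDividingTree L (tupleProd S T) α) : ∃ γ δ, HasDividingTree L S γ ∧
      HasDividingTree L T δ ∧ α ≤ natSum γ δ := by
  obtain ⟨P, p, Φ, hΦ⟩ := hS.exists_formulas
  obtain ⟨P', p', Φ', hΦ'⟩ := hT.exists_formulas
  have htree : HasTreeOn L (tupleProd S T) α.ToType := (hasDividingTree_iff.1 h).comp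
    (e := Ordinal.ToType.mk.symm) Ordinal.ToType.mk.symm.strictMono
  let f : ι ⊕ P → (ι ⊕ κ) ⊕ (P ⊕ P') := Sum.map Sum.inl Sum.inl
  let f' : κ ⊕ P' → (ι ⊕ κ) ⊕ (P ⊕ P') := Sum.map Sum.inr Sum.inr
  have hST : ∀ x, x ∈ tupleProd S T ↔ ∀ φ ∈ (fun φ => φ.relabel f) '' Φ ∪
      (fun φ => φ.relabel f') '' Φ', φ.Realize (Sum.elim x (Sum.elim p p')) := by
    intro x
    have h1 : Sum.elim x (Sum.elim p p') ∘ f = Sum.elim (x ∘ Sum.inl) p := by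
      funext r; rcases r with r | r <;> rfl
    have h2 : Sum.elim x (Sum.elim p p') ∘ f' = Sum.elim (x ∘ Sum.inr) p' := by
      funext r; rcases r with r | r <;> rfl
    simp only [mem_union, or_imp, forall_and, forall_mem_image]
    simp only [Formula.realize_relabel, h1, h2, ← hΦ, ← hΦ']
    rfl
  obtain ⟨c, hc, hchain⟩ := htree.exists_chain hM hST
  rw [← Sum.elim_comp_inl_inr c] at hchain
  obtain ⟨s, ⟨B, B', h1, h2, h3⟩, ⟨C, C', h1', h2', h3'⟩⟩ := hchain.exists_split hM
  have hp : range p ⊆ range (Sum.elim p p') := by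
    rintro _ ⟨r, rfl⟩
    exact ⟨Sum.inl r, rfl⟩
  have hp' : range p' ⊆ range (Sum.elim p p') := by
    rintro _ ⟨r, rfl⟩
    exact ⟨Sum.inr r, rfl⟩
  refine ⟨_, _, (HasDividingChain.hasTreeOn hM hΦ hc.1
    ⟨B, B', h1, fun j => hp.trans (h2 j), h3⟩).hasDividingTree_type,
    (HasDividingChain.hasTreeOn hM hΦ' hc.2
    ⟨C, C', h1', fun j => hp'.trans (h2' j), h3'⟩).hasDividingTree_type, le_natSum_type s⟩

end Depths

/-! ### Arithmetic of extended ordinals and values of the depth -/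

section ExtendedOrdinals

theorem oplus_le_oplus {α β : Ordinal.{u}} : oplus α ≤ oplus β ↔ α ≤ β := by
  simp [oplus, WithTop.coe_le_coe, Prod.Lex.toLex_le_toLex, ← le_iff_lt_or_eq]

theorem oplus_le_ominus {α β : Ordinal.{u}} : oplus α ≤ ominus β ↔ α < β := by
  simp [oplus, ominus, WithTop.coe_le_coe, Prod.Lex.toLex_le_toLex]

theorem ominus_le_oplus {α β : Ordinal.{u}} : ominus α ≤ oplus β ↔ α ≤ β := by
  simp [oplus, ominus, WithTop.coe_le_coe, Prod.Lex.toLex_le_toLex, ← le_iff_lt_or_eq]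

theorem ominus_le_ominus {α β : Ordinal.{u}} : ominus α ≤ ominus β ↔ α ≤ β := by
  simp [ominus, WithTop.coe_le_coe, Prod.Lex.toLex_le_toLex, ← le_iff_lt_or_eq]

/-- The extended ordinals that are possible values of the dividing depth. -/
inductive IsProper : ExtOrd.{u} → Prop
  | top : IsProper ⊤
  | plus (α : Ordinal.{u}) : IsProper (oplus α)
  | minus (α : Ordinal.{u}) (h : Order.IsSuccLimit α) : IsProper (ominus α)

theorem exists_of_extOrd (e : ExtOrd.{u}) :
    e = ⊤ ∨ (∃ α, e = oplus α) ∨ ∃ α, e = ominus α := by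
  induction e using WithTop.recTopCoe with
  | top => exact Or.inl rfl
  | coe p =>
    obtain ⟨α, b⟩ := p
    cases b
    · exact Or.inr (Or.inr ⟨α, rfl⟩)
    · exact Or.inr (Or.inl ⟨α, rfl⟩)

/-- A possible value of the dividing depth is determined by the ordinals `ξ` with `ξ₊` below it. -/
theorem IsProper.le_of_forall {e e' : ExtOrd.{u}} (he : IsProper e)
    (h : ∀ ξ, oplus ξ ≤ e → oplus ξ ≤ e') : e ≤ e' := by
  cases he with
  | top =>
    rcases exists_of_extOrd e' with rfl | ⟨β, rfl⟩ | ⟨β, rfl⟩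
    · exact le_rfl
    · exact absurd (oplus_le_oplus.1 (h (Order.succ β) le_top)) (Order.lt_succ β).not_ge
    · exact absurd (oplus_le_ominus.1 (h β le_top)) (lt_irrefl β)
  | plus α => exact h α le_rfl
  | minus α hα =>
    rcases exists_of_extOrd e' with rfl | ⟨β, rfl⟩ | ⟨β, rfl⟩
    · exact le_top
    · refine ominus_le_oplus.2 (le_of_not_gt fun hlt => ?_)
      exact absurd (oplus_le_oplus.1 (h _ (oplus_le_ominus.2 (hα.succ_lt hlt))))
        (Order.lt_succ β).not_ge
    · refine ominus_le_ominus.2 (le_of_not_gt fun hlt => ?_)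
      exact absurd (oplus_le_ominus.1 (h _ (oplus_le_ominus.2 hlt))) (lt_irrefl β)

theorem IsProper.oplus_zero_le {e : ExtOrd.{u}} (he : IsProper e) : oplus 0 ≤ e := by
  cases he with
  | top => exact le_top
  | plus α => exact oplus_le_oplus.2 zero_le
  | minus α hα => exact oplus_le_ominus.2 hα.bot_lt

theorem hatAdd_top_left (e : ExtOrd.{u}) : hatAdd ⊤ e = ⊤ := by
  rcases exists_of_extOrd e with rfl | ⟨β, rfl⟩ | ⟨β, rfl⟩ <;> rfl

theorem hatAdd_top_right (e : ExtOrd.{u}) : hatAdd e ⊤ = ⊤ := by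
  rcases exists_of_extOrd e with rfl | ⟨β, rfl⟩ | ⟨β, rfl⟩ <;> rfl

theorem hatNatAdd_top_left (e : ExtOrd.{u}) : hatNatAdd ⊤ e = ⊤ := by
  rcases exists_of_extOrd e with rfl | ⟨β, rfl⟩ | ⟨β, rfl⟩ <;> rfl

theorem hatNatAdd_top_right (e : ExtOrd.{u}) : hatNatAdd e ⊤ = ⊤ := by
  rcases exists_of_extOrd e with rfl | ⟨β, rfl⟩ | ⟨β, rfl⟩ <;> rfl

open Classical in
theorem hatAdd_ominus_oplus (α β : Ordinal.{u}) : hatAdd (ominus α) (oplus β) =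
    if sSup {ξ | ∃ γ < α, ξ = γ + β} ∈ {ξ | ∃ γ < α, ξ = γ + β} then
      oplus (sSup {ξ | ∃ γ < α, ξ = γ + β})
    else ominus (sSup {ξ | ∃ γ < α, ξ = γ + β}) := rfl

theorem add_le_sSup {α β γ : Ordinal.{u}} (h : γ < α) :
    γ + β ≤ sSup {ξ | ∃ γ < α, ξ = γ + β} := by
  refine le_csSup ⟨α + β, ?_⟩ ⟨γ, h, rfl⟩
  rintro _ ⟨γ, hγ, rfl⟩
  gcongr

theorem exists_lt_add_of_lt_sSup {α β ξ : Ordinal.{u}}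
    (h : ξ < sSup {ξ | ∃ γ < α, ξ = γ + β}) : ∃ γ < α, ξ < γ + β := by
  by_contra! hc
  refine h.not_ge (csSup_le' ?_)
  rintro _ ⟨γ, hγ, rfl⟩
  exact hc γ hγ

/-- Needed to apply `IsProper.le_of_forall` with the sum on the left. A supremum that is not
attained is a limit, and so is a supremum of limits `γ + β`. -/
theorem IsProper.hatAdd {e e' : ExtOrd.{u}} (he : IsProper e) (he' : IsProper e') :
    IsProper (hatAdd e e') := by
  cases he with
  | top => rw [hatAdd_top_left]; exact .top
  | plus α =>
    cases he' with
    | top => rw [hatAdd_top_right]; exact .top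
    | plus β => exact .plus _
    | minus β hβ => exact .minus _ (Ordinal.isSuccLimit_add _ hβ)
  | minus α hα =>
    have h0 : (0 : Ordinal.{u}) < α := hα.bot_lt
    cases he' with
    | top => rw [hatAdd_top_right]; exact .top
    | plus β =>
      rw [hatAdd_ominus_oplus]
      split_ifs with h
      · exact .plus _
      · have hlt : ∀ γ < α, γ + β < sSup {ξ | ∃ γ < α, ξ = γ + β} := fun γ hγ =>
          (add_le_sSup hγ).lt_of_ne fun heq => h ⟨γ, hγ, heq.symm⟩
        refine .minus _ ⟨not_isMin_of_lt (hlt 0 h0),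
          Order.isSuccPrelimit_of_succ_lt fun ξ hξ => ?_⟩
        obtain ⟨γ, hγ, hξγ⟩ := exists_lt_add_of_lt_sSup hξ
        exact (Order.succ_le_of_lt hξγ).trans_lt (hlt γ hγ)
    | minus β hβ =>
      refine .minus _ ⟨not_isMin_of_lt (((Ordinal.isSuccLimit_add 0 hβ).bot_lt).trans_le
        (add_le_sSup h0)), Order.isSuccPrelimit_of_succ_lt fun ξ hξ => ?_⟩
      obtain ⟨γ, hγ, hξγ⟩ := exists_lt_add_of_lt_sSup hξ
      exact ((Ordinal.isSuccLimit_add γ hβ).succ_lt hξγ).trans_le (add_le_sSup hγ)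

/-- Continuity of ordinal addition in its right argument gives `δ` when `β` is a limit; a supremum
over `γ < α` is approximated by its members. -/
theorem IsProper.exists_le_add {e e' : ExtOrd.{u}} (he : IsProper e) (he' : IsProper e')
    {ξ : Ordinal.{u}} (h : oplus ξ ≤ DividingDepth.hatAdd e e') :
    ∃ γ δ, oplus γ ≤ e ∧ oplus δ ≤ e' ∧ ξ ≤ γ + δ := by
  have key : ∀ {γ β : Ordinal.{u}}, Order.IsSuccLimit β → ξ < γ + β → ∃ δ < β, ξ ≤ γ + δ :=
    fun hβ hξ => (Ordinal.lt_add_iff hβ.bot_lt.ne').1 hξ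
  cases he with
  | top => exact ⟨ξ, 0, le_top, he'.oplus_zero_le, by simp⟩
  | plus α =>
    cases he' with
    | top => exact ⟨0, ξ, oplus_le_oplus.2 zero_le, le_top, by simp⟩
    | plus β => exact ⟨α, β, le_rfl, le_rfl, oplus_le_oplus.1 h⟩
    | minus β hβ =>
      obtain ⟨δ, hδ, hξ⟩ := key hβ (oplus_le_ominus.1 h)
      exact ⟨α, δ, le_rfl, oplus_le_ominus.2 hδ, hξ⟩
  | minus α hα =>
    cases he' with
    | top => exact ⟨0, ξ, oplus_le_ominus.2 hα.bot_lt, le_top, by simp⟩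
    | plus β =>
      rw [hatAdd_ominus_oplus] at h
      split_ifs at h with hs
      · obtain ⟨γ, hγ, hs⟩ := hs
        rw [hs] at h
        exact ⟨γ, β, oplus_le_ominus.2 hγ, le_rfl, oplus_le_oplus.1 h⟩
      · obtain ⟨γ, hγ, hξ⟩ := exists_lt_add_of_lt_sSup (oplus_le_ominus.1 h)
        exact ⟨γ, β, oplus_le_ominus.2 hγ, le_rfl, hξ.le⟩
    | minus β hβ =>
      obtain ⟨γ, hγ, hξ⟩ := exists_lt_add_of_lt_sSup (oplus_le_ominus.1 h)
      obtain ⟨δ, hδ, hξ⟩ := key hβ hξ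
      exact ⟨γ, δ, oplus_le_ominus.2 hγ, oplus_le_ominus.2 hδ, hξ⟩

theorem IsProper.oplus_natSum_le {e e' : ExtOrd.{u}} (he : IsProper e) (he' : IsProper e')
    {γ δ : Ordinal.{u}} (h : oplus γ ≤ e) (h' : oplus δ ≤ e') :
    oplus (natSum γ δ) ≤ hatNatAdd e e' := by
  cases he with
  | top => rw [hatNatAdd_top_left]; exact le_top
  | plus α =>
    rw [oplus_le_oplus] at h
    cases he' with
    | top => rw [hatNatAdd_top_right]; exact le_top
    | plus β => exact oplus_le_oplus.2 (natSum_le_natSum h (oplus_le_oplus.1 h'))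
    | minus β hβ =>
      exact oplus_le_ominus.2 ((natSum_le_natSum h le_rfl).trans_lt
        (natSum_lt_right α (oplus_le_ominus.1 h')))
  | minus α hα =>
    rw [oplus_le_ominus] at h
    cases he' with
    | top => rw [hatNatAdd_top_right]; exact le_top
    | plus β =>
      exact oplus_le_ominus.2 ((natSum_le_natSum le_rfl (oplus_le_oplus.1 h')).trans_lt
        (natSum_lt_left h β))
    | minus β hβ =>
      -- As `α` is a limit, `succ γ` is still below it; its sum with `δ` shows that `natSum γ δ` is
      -- strictly below the supremum.
      refine oplus_le_ominus.2 ((natSum_lt_left (Order.lt_succ γ) δ).trans_le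
        (le_csSup ⟨natSum α β, ?_⟩ ⟨_, hα.succ_lt h, δ, oplus_le_ominus.1 h', rfl⟩))
      rintro _ ⟨γ, hγ, δ, hδ, rfl⟩
      exact natSum_le_natSum hγ.le hδ.le

variable {L : FirstOrder.Language.{u, u}} {M : Type v} [L.Structure M]

theorem isProper_DD {ι : Type u} (S : Set (ι → M)) : IsProper (DD L S) := by
  rw [DD]
  split_ifs with h h'
  · exact .minus _ h'.1
  · exact .plus _
  · exact .top

/-- The depths of trees are closed downwards and include `0` as `S` is nonempty, so `DD` records
exactly this initial segment. -/
theorem oplus_le_DD {ι : Type u} {S : Set (ι → M)} (hS : S.Nonempty) {ξ : Ordinal.{u}} :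
    oplus ξ ≤ DD L S ↔ HasDividingTree L S ξ := by
  have h0 : {α | HasDividingTree L S α}.Nonempty := ⟨0, hasDividingTree_zero hS⟩
  have hlt : ξ < sSup {α | HasDividingTree L S α} → HasDividingTree L S ξ := fun h => by
    obtain ⟨α, hα, hξ⟩ := exists_lt_of_lt_csSup h0 h
    exact hα.mono hξ.le
  rw [DD]
  split_ifs with h h'
  · rw [oplus_le_ominus]
    exact ⟨hlt, fun hξ => (le_csSup h hξ).lt_of_ne fun heq => h'.2 (heq ▸ hξ)⟩
  · rw [oplus_le_oplus]
    refine ⟨fun hξ => ?_, fun hξ => le_csSup h hξ⟩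
    rcases hξ.lt_or_eq with hξ | rfl
    · exact hlt hξ
    · by_contra hn
      -- An unattained supremum is a limit: it is not `0`, which is attained, and every smaller
      -- ordinal lies below some depth strictly under the supremum.
      refine h' ⟨⟨fun hmin => hn ?_, Order.isSuccPrelimit_of_succ_lt fun ξ hξ => ?_⟩, hn⟩
      · rw [hmin.eq_bot]
        exact hasDividingTree_zero hS
      · obtain ⟨α, hα, hlt⟩ := exists_lt_of_lt_csSup h0 hξ
        refine (Order.succ_le_of_lt hlt).trans_lt ((le_csSup h hα).lt_of_ne fun heq => hn ?_)
        rw [← heq]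
        exact hα
  · refine ⟨fun _ => ?_, fun _ => le_top⟩
    obtain ⟨α, hα, hξ⟩ := not_bddAbove_iff.1 h ξ
    exact hα.mono hξ.le

theorem hatAdd_DD_le {ι κ η : Type u} {S : Set (ι → M)} {T : Set (κ → M)} {R : Set (η → M)}
    (r : ι → η) (r' : κ → η) (hR : ∀ x ∈ S, ∀ y ∈ T, ∃ z ∈ R, z ∘ r = x ∧ z ∘ r' = y)
    (hS : S.Nonempty) (hT : T.Nonempty) : hatAdd (DD L S) (DD L T) ≤ DD L R := by
  have hR₀ : R.Nonempty := by
    obtain ⟨x, hx⟩ := hS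
    obtain ⟨y, hy⟩ := hT
    obtain ⟨z, hz, -⟩ := hR x hx y hy
    exact ⟨z, hz⟩
  refine ((isProper_DD S).hatAdd (isProper_DD T)).le_of_forall fun ξ hξ => ?_
  obtain ⟨γ, δ, hγ, hδ, hle⟩ := (isProper_DD S).exists_le_add (isProper_DD T) hξ
  rw [oplus_le_DD hS] at hγ
  rw [oplus_le_DD hT] at hδ
  exact (oplus_le_DD hR₀).2 ((hγ.add r r' hR hδ).mono hle)

end ExtendedOrdinals

end DividingDepth

theorem proposition4p10 (L : FirstOrder.Language.{u, u}) (M : Type v) [L.Structure M]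
    (hM : DividingDepth.IsMonster L M) {ι κ : Type u} (S : Set (ι → M)) (T : Set (κ → M))
    (hS : DividingDepth.IsTypeDefinable L S) (hT : DividingDepth.IsTypeDefinable L T)
    (hS₀ : S.Nonempty) (hT₀ : T.Nonempty) :
    max (DividingDepth.hatAdd (DividingDepth.DD L S) (DividingDepth.DD L T))
        (DividingDepth.hatAdd (DividingDepth.DD L T) (DividingDepth.DD L S)) ≤
      DividingDepth.DD L (DividingDepth.tupleProd S T) ∧
    DividingDepth.DD L (DividingDepth.tupleProd S T) ≤
      DividingDepth.hatNatAdd (DividingDepth.DD L S) (DividingDepth.DD L T) := by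
  have hpair : ∀ x ∈ S, ∀ y ∈ T, Sum.elim x y ∈ DividingDepth.tupleProd S T :=
    fun x hx y hy => ⟨hx, hy⟩
  refine ⟨max_le ?_ ?_, ?_⟩
  · exact DividingDepth.hatAdd_DD_le Sum.inl Sum.inr
      (fun x hx y hy => ⟨_, hpair x hx y hy, rfl, rfl⟩) hS₀ hT₀
  · exact DividingDepth.hatAdd_DD_le Sum.inr Sum.inl
      (fun y hy x hx => ⟨_, hpair x hx y hy, rfl, rfl⟩) hT₀ hS₀
  · refine (DividingDepth.isProper_DD _).le_of_forall fun ξ hξ => ?_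
    obtain ⟨x, hx⟩ := hS₀
    obtain ⟨y, hy⟩ := hT₀
    rw [DividingDepth.oplus_le_DD ⟨_, hpair x hx y hy⟩] at hξ
    obtain ⟨γ, δ, hγ, hδ, hle⟩ := hξ.exists_split hM hS hT
    exact (DividingDepth.oplus_le_oplus.2 hle).trans
      ((DividingDepth.isProper_DD S).oplus_natSum_le (DividingDepth.isProper_DD T)
        ((DividingDepth.oplus_le_DD ⟨x, hx⟩).2 hγ) ((DividingDepth.oplus_le_DD ⟨y, hy⟩).2 hδ))
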